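/- For a sequence $\mathbf s=(s_1,\dots,s_n)$ of positive integers, the lecture hall simplex is $$\mathcal P_n^{\mathbf s}=\Bigl\{x\in\mathbb R^n : 0\le \frac{x_1}{s_1}\le\cdots\le\frac{x_n}{s_n}\le 1\Bigr\}.$$ The Ehrhart polynomial of a lattice polytope $P\subset\mathbb R^n$ is the unique polynomial $L_P$ with $L_P(t)=\lvert tP\cap\mathbb Z^n\rvert$ for all integers $t\ge 1$, and $P$ is called Ehrhart positive if all coefficients of $L_P$ (in the monomial basis) are non-negative. Fix $n\ge 5$ and, for integers $a\ge 1$, let $\mathbf s(a)=(a,\dots,a,a+1)$ be of length $n$. Then $\mathcal P_n^{\mathbf s(a)}$ has an Ehrhart polynomial for every $a\ge 1$, and: (i) there is $\alpha(n)$ such that for all integers $a\ge\alpha(n)$ the simplex $\mathcal P_n^{\mathbf s(a)}$ is not Ehrhart positive; (ii) more precisely, as $a\to\infty$, the coefficient of $t^{n-4}$ in the Ehrhart polynomial satisfies $$[t^{n-4}]\,L_{\mathcal P_n^{\mathbf s(a)}}(t)\;\sim\;-\frac{1}{720\,(n-4)!}\,a^{n-1}.$$ -/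

import Mathlib

open Filter Asymptotics
open scoped Nat Pointwise

/-- The `s`-lecture hall simplex: the points `x` of `ℝⁿ` with
`0 ≤ x₁ / s₁ ≤ ⋯ ≤ xₙ / sₙ ≤ 1`, for a sequence `s` of positive integers. -/
def lectureHallSimplex {n : ℕ} (s : Fin n → ℕ) : Set (Fin n → ℝ) :=
  {x | (∀ i, 0 ≤ x i / (s i : ℝ)) ∧ (∀ i j, i ≤ j → x i / (s i : ℝ) ≤ x j / (s j : ℝ)) ∧
    ∀ i, x i / (s i : ℝ) ≤ 1}

/-- The sequence `(a, …, a, a + 1)` of length `n`. -/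
def almostConstantSeq (n a : ℕ) : Fin n → ℕ :=
  fun i => if (i : ℕ) + 1 = n then a + 1 else a

/-- The number of points of `ℤⁿ` in the dilate `t P`, for a bounded set `P`. -/
noncomputable def latticePointCount {n : ℕ} (P : Set (Fin n → ℝ)) (t : ℕ) : ℕ :=
  Set.ncard {z : Fin n → ℤ | (fun i => (z i : ℝ)) ∈ (t : ℝ) • P}

/-- `L` is the Ehrhart polynomial of `P`: it counts the lattice points of all positive integer
dilates of `P`. -/
def IsEhrhartPolynomial {n : ℕ} (P : Set (Fin n → ℝ)) (L : Polynomial ℝ) : Prop :=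
  ∀ t : ℕ, 0 < t → L.eval (t : ℝ) = (latticePointCount P t : ℝ)

theorem IsEhrhartPolynomial.unique {n : ℕ} {P : Set (Fin n → ℝ)} {L M : Polynomial ℝ}
    (hL : IsEhrhartPolynomial P L) (hM : IsEhrhartPolynomial P M) : L = M := by
  refine Polynomial.eq_of_infinite_eval_eq L M ?_
  have hinj : Function.Injective (fun k : ℕ => ((k + 1 : ℕ) : ℝ)) := by
    intro a b hab
    simpa using hab
  refine (Set.infinite_range_of_injective hinj).mono ?_
  rintro _ ⟨k, rfl⟩
  exact (hL (k + 1) k.succ_pos).trans (hM (k + 1) k.succ_pos).symm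

open Classical in
/-- The Ehrhart polynomial of `P`, which is unique if it exists (the value is `0` if it does
not exist). -/
noncomputable def ehrhartPolynomial {n : ℕ} (P : Set (Fin n → ℝ)) : Polynomial ℝ :=
  if h : ∃ L : Polynomial ℝ, IsEhrhartPolynomial P L then h.choose else 0

theorem IsEhrhartPolynomial.ehrhartPolynomial_eq {n : ℕ} {P : Set (Fin n → ℝ)}
    {L : Polynomial ℝ} (hL : IsEhrhartPolynomial P L) : ehrhartPolynomial P = L := by
  have h : ∃ L : Polynomial ℝ, IsEhrhartPolynomial P L := ⟨L, hL⟩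
  rw [ehrhartPolynomial, dif_pos h]
  exact h.choose_spec.unique hL

/-- `P` is Ehrhart positive if its Ehrhart polynomial has no negative coefficient. -/
def EhrhartPositive {n : ℕ} (P : Set (Fin n → ℝ)) : Prop :=
  ∀ k : ℕ, 0 ≤ (ehrhartPolynomial P).coeff k

/-! Put d = n - 1 and fix the last coordinate k of a lattice point of the t-th dilate, 0 ≤ k ≤
t(a+1). The other coordinates form a weakly increasing sequence bounded by ⌊ak/(a+1)⌋, so they
contribute a binomial coefficient (`card_monotoneSeqs`). These floors run through 0, …, ta, and
exactly the values qa with q < t occur twice, so the count is C(ta+d+1, d+1) + ∑_{q<t} C(qa+d, d)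
(`sum_choose_floor`).

The first summand is a polynomial in ta, so it contributes only order a^(n-4) to the coefficient of
t^(n-4). In the second, the top term (a^d/d!) ∑_{q<t} q^d dominates; by Faulhaber's formula its
coefficient at t^(d-3) is a positive multiple of B₄ = -1/30, whence the sign (`coeff_powerSumPoly`).
-/

section Counting

/-- The weakly increasing sequences `0 ≤ z₁ ≤ ⋯ ≤ z_d ≤ m` of integers. -/
def monotoneSeqs : (d : ℕ) → ℕ → Finset (Fin d → ℤ)
  | 0, _ => Finset.univ
  | d + 1, m => (Finset.range (m + 1)).biUnion fun k =>
      (monotoneSeqs d k).image fun y => Fin.snoc (α := fun _ => ℤ) y (k : ℤ)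

theorem card_biUnion_image_snoc {d : ℕ} (F : ℕ → Finset (Fin d → ℤ)) (N : ℕ) :
    ((Finset.range N).biUnion fun k =>
      (F k).image fun y => Fin.snoc (α := fun _ => ℤ) y (k : ℤ)).card =
        ∑ k ∈ Finset.range N, (F k).card := by
  rw [Finset.card_biUnion]
  · refine Finset.sum_congr rfl fun k _ => Finset.card_image_of_injective _ fun y y' h => ?_
    exact (Fin.snoc_injective2 (α := fun _ => ℤ) h).1
  · intro k _ l _ hkl
    rw [Function.onFun, Finset.disjoint_left]
    intro z hz hz'
    obtain ⟨y, -, rfl⟩ := Finset.mem_image.1 hz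
    obtain ⟨y', -, h⟩ := Finset.mem_image.1 hz'
    have := (Fin.snoc_injective2 (α := fun _ => ℤ) h).2
    exact hkl (by exact_mod_cast this.symm)

theorem mem_biUnion_image_snoc {d : ℕ} (F : ℕ → Finset (Fin d → ℤ)) (N : ℕ)
    (z : Fin (d + 1) → ℤ) :
    (z ∈ (Finset.range (N + 1)).biUnion fun k =>
      (F k).image fun y => Fin.snoc (α := fun _ => ℤ) y (k : ℤ)) ↔
        0 ≤ z (Fin.last d) ∧ z (Fin.last d) ≤ N ∧
          (fun i : Fin d => z i.castSucc) ∈ F (z (Fin.last d)).toNat := by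
  simp only [Finset.mem_biUnion, Finset.mem_range, Finset.mem_image]
  constructor
  · rintro ⟨k, hk, y, hy, rfl⟩
    simp only [Fin.snoc_last, Fin.snoc_castSucc, Int.toNat_natCast]
    exact ⟨by omega, by omega, hy⟩
  · rintro ⟨h0, hN, hz⟩
    refine ⟨(z (Fin.last d)).toNat, by omega, _, hz, ?_⟩
    rw [Int.toNat_of_nonneg h0]
    exact Fin.snoc_init_self z

theorem card_monotoneSeqs (d m : ℕ) : (monotoneSeqs d m).card = (m + d).choose d := by
  induction d generalizing m with
  | zero => simp [monotoneSeqs]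
  | succ d ih =>
    rw [monotoneSeqs, card_biUnion_image_snoc, Finset.sum_congr rfl fun k _ => ih k,
      Nat.sum_range_add_choose, add_assoc]

theorem mem_monotoneSeqs {d m : ℕ} {z : Fin d → ℤ} :
    z ∈ monotoneSeqs d m ↔ (∀ i, 0 ≤ z i) ∧ Monotone z ∧ ∀ i, z i ≤ m := by
  induction d generalizing m with
  | zero =>
    exact iff_of_true (Finset.mem_univ z) ⟨finZeroElim, Subsingleton.monotone z, finZeroElim⟩
  | succ d ih =>
    rw [monotoneSeqs, mem_biUnion_image_snoc, ih]
    constructor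
    · rintro ⟨h0, hm, h1, h2, h3⟩
      have h3' : ∀ i : Fin d, z i.castSucc ≤ z (Fin.last d) := fun i => by
        have := h3 i
        omega
      refine ⟨Fin.lastCases h0 h1, ?_, Fin.lastCases hm fun i => (h3' i).trans hm⟩
      intro i j hij
      induction j using Fin.lastCases with
      | last =>
        induction i using Fin.lastCases with
        | last => exact le_rfl
        | cast i => exact h3' i
      | cast j =>
        induction i using Fin.lastCases with
        | last => exact absurd hij (by simp)
        | cast i => exact h2 (by simpa using hij)
    · rintro ⟨h1, h2, h3⟩
      refine ⟨h1 _, h3 _, fun i => h1 _, fun i j hij => h2 (by simpa using hij), fun i => ?_⟩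
      have := h2 (Fin.le_last i.castSucc)
      have := h1 (Fin.last d)
      omega

theorem almostConstantSeq_castSucc {d : ℕ} (a : ℕ) (i : Fin d) :
    almostConstantSeq (d + 1) a i.castSucc = a := by
  have := i.isLt
  simp [almostConstantSeq, this.ne]

theorem almostConstantSeq_last (d a : ℕ) :
    almostConstantSeq (d + 1) a (Fin.last d) = a + 1 := by
  simp [almostConstantSeq]

theorem mem_smul_lectureHallSimplex_iff {d a t : ℕ} (ha : 0 < a) (ht : 0 < t)
    (z : Fin (d + 1) → ℤ) :
    (fun i => (z i : ℝ)) ∈ (t : ℝ) • lectureHallSimplex (almostConstantSeq (d + 1) a) ↔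
      0 ≤ z (Fin.last d) ∧ z (Fin.last d) ≤ (t * (a + 1) : ℕ) ∧
        (fun i : Fin d => z i.castSucc) ∈
          monotoneSeqs d (a * (z (Fin.last d)).toNat / (a + 1)) := by
  have ht' : (0 : ℝ) < t := by exact_mod_cast ht
  have ha' : (0 : ℝ) < a := by exact_mod_cast ha
  rw [Set.mem_smul_set_iff_inv_smul_mem₀ ht'.ne', mem_monotoneSeqs]
  simp only [lectureHallSimplex, Set.mem_ofPred_eq, Pi.smul_apply, smul_eq_mul, Fin.forall_fin_succ',
    almostConstantSeq_castSucc, almostConstantSeq_last]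
  have e0 : ∀ (x : ℤ) (s : ℕ), 0 < s → (0 ≤ (t : ℝ)⁻¹ * x / s ↔ 0 ≤ x) := by
    intro x s hs
    have hs' : (0 : ℝ) < s := by exact_mod_cast hs
    rw [le_div_iff₀ hs', zero_mul, mul_nonneg_iff_of_pos_left (inv_pos.2 ht')]
    exact_mod_cast Iff.rfl
  have e1 : ∀ (x : ℤ) (s : ℕ), 0 < s → ((t : ℝ)⁻¹ * x / s ≤ 1 ↔ x ≤ (t * s : ℕ)) := by
    intro x s hs
    have hs' : (0 : ℝ) < s := by exact_mod_cast hs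
    rw [div_le_one hs', inv_mul_le_iff₀ ht']
    exact_mod_cast Iff.rfl
  have e2 : ∀ (x y : ℤ) (r s : ℕ), 0 < r → 0 < s →
      ((t : ℝ)⁻¹ * x / r ≤ (t : ℝ)⁻¹ * y / s ↔ x * s ≤ y * r) := by
    intro x y r s hr hs
    have hr' : (0 : ℝ) < r := by exact_mod_cast hr
    have hs' : (0 : ℝ) < s := by exact_mod_cast hs
    rw [div_le_div_iff₀ hr' hs', mul_assoc, mul_assoc, mul_le_mul_iff_right₀ (inv_pos.2 ht')]
    exact_mod_cast Iff.rfl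
  simp only [e0 _ _ ha, e0 _ _ a.succ_pos, e1 _ _ ha, e1 _ _ a.succ_pos, e2 _ _ _ _ ha ha,
    e2 _ _ _ _ ha a.succ_pos, e2 _ _ _ _ a.succ_pos ha, e2 _ _ _ _ a.succ_pos a.succ_pos]
  have haz : (0 : ℤ) < a := by exact_mod_cast ha
  set w := z (Fin.last d)
  have key : 0 ≤ w → ∀ x : ℤ, x ≤ (a * w.toNat / (a + 1) : ℕ) ↔ x * (a + 1 : ℕ) ≤ w * a := by
    intro hw x
    push_cast
    rw [Int.toNat_of_nonneg hw, Int.le_ediv_iff_mul_le (by positivity), mul_comm (a : ℤ) w]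
  constructor
  · rintro ⟨⟨h0, hw0⟩, ⟨hm, -⟩, h1, hw1⟩
    refine ⟨hw0, hw1, h0, fun i j hij => ?_, fun i => ?_⟩
    · exact le_of_mul_le_mul_right ((hm i).1 j (by simpa using hij)) haz
    · exact (key hw0 _).2 ((hm i).2 (Fin.le_last _))
  · rintro ⟨hw0, hw1, h0, hm, h1⟩
    have h1' := fun i => (key hw0 _).1 (h1 i)
    refine ⟨⟨h0, hw0⟩, ⟨fun i => ⟨fun j hij => ?_, fun _ => h1' i⟩,
      fun j hj => absurd hj (by simp), fun _ => le_rfl⟩, fun i => ?_, hw1⟩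
    · exact mul_le_mul_of_nonneg_right (hm (by simpa using hij)) haz.le
    -- The bound by ta follows from xᵢ(a+1) ≤ wa ≤ t(a+1)a.
    · have h2 := h1' i
      push_cast at h2 hw1 ⊢
      nlinarith [h0 i]

theorem latticePointCount_almostConstantSeq (d : ℕ) {a t : ℕ} (ha : 0 < a) (ht : 0 < t) :
    latticePointCount (lectureHallSimplex (almostConstantSeq (d + 1) a)) t =
      ∑ k ∈ Finset.range (t * (a + 1) + 1), (a * k / (a + 1) + d).choose d := by
  rw [latticePointCount, ← Finset.sum_congr rfl fun k _ => card_monotoneSeqs d (a * k / (a + 1)),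
    ← card_biUnion_image_snoc, ← Set.ncard_coe_finset]
  congr 1
  ext z
  rw [Set.mem_ofPred_eq, mem_smul_lectureHallSimplex_iff ha ht, Finset.mem_coe,
    mem_biUnion_image_snoc]

theorem sum_choose_floor (d a t : ℕ) :
    ∑ k ∈ Finset.range (t * (a + 1) + 1), (a * k / (a + 1) + d).choose d =
      (t * a + (d + 1)).choose (d + 1) + ∑ q ∈ Finset.range t, (q * a + d).choose d := by
  induction t with
  | zero => simp
  | succ t ih =>
    -- The new block of indices gives the floors ta, …, ta+a; the value ta already came from k =
    -- t(a+1), and this repetition is the new summand q = t.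
    have hfloor : ∀ j ∈ Finset.range (a + 1),
        (a * (t * (a + 1) + 1 + j) / (a + 1) + d).choose d = (t * a + j + d).choose d := by
      intro j hj
      have hj' : j ≤ a := Nat.lt_succ_iff.1 (Finset.mem_range.1 hj)
      have : a * (t * (a + 1) + 1 + j) / (a + 1) = t * a + j := by
        -- Here c = a - j is the remainder of the division by a + 1.
        obtain ⟨c, rfl⟩ := Nat.exists_eq_add_of_le hj'
        rw [Nat.div_eq_iff (by positivity), Nat.le_sub_iff_add_le (by omega)]
        constructor <;> nlinarith
      rw [this]
    have hsplit : ∑ k ∈ Finset.range ((t + 1) * a + 1), (k + d).choose d =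
        ∑ k ∈ Finset.range (t * a), (k + d).choose d +
          ∑ j ∈ Finset.range (a + 1), (t * a + j + d).choose d := by
      rw [show (t + 1) * a + 1 = t * a + (a + 1) by ring, Finset.sum_range_add]
    have h := Nat.sum_range_add_choose (t * a) d
    rw [Finset.sum_range_succ] at h
    rw [Nat.sum_range_add_choose] at hsplit
    rw [show (t + 1) * (a + 1) + 1 = t * (a + 1) + 1 + (a + 1) by ring, Finset.sum_range_add, ih,
      Finset.sum_congr rfl hfloor, Finset.sum_range_succ _ t]
    simp only [add_assoc] at *
    omega

end Counting

/-! ### The Ehrhart polynomial and its coefficient asymptotics -/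

section EhrhartPolynomial

open Polynomial

/-- The polynomial whose value at `n : ℕ` is the power sum `∑ k < n, k ^ p`. -/
noncomputable def powerSumPoly (p : ℕ) : ℝ[X] :=
  C ((p + 1 : ℝ)⁻¹) *
    ((Polynomial.bernoulli (p + 1)).map (algebraMap ℚ ℝ) - C ((_root_.bernoulli (p + 1) : ℚ) : ℝ))

theorem eval_powerSumPoly (p n : ℕ) :
    (powerSumPoly p).eval (n : ℝ) = ∑ k ∈ Finset.range n, (k : ℝ) ^ p := by
  have h := congrArg (fun q : ℚ => (q : ℝ)) (Polynomial.sum_range_pow_eq_bernoulli_sub n p)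
  have hp : (p + 1 : ℝ) ≠ 0 := by positivity
  have he : ((Polynomial.bernoulli (p + 1)).map (algebraMap ℚ ℝ)).eval (n : ℝ) =
      (((Polynomial.bernoulli (p + 1)).eval (n : ℚ) : ℚ) : ℝ) := by
    rw [← map_natCast (algebraMap ℚ ℝ) n, eval_map_algebraMap, aeval_algebraMap_apply,
      coe_aeval_eq_eval]
    rfl
  rw [powerSumPoly, eval_mul, eval_sub, eval_C, eval_C, he, inv_mul_eq_iff_eq_mul₀ hp]
  push_cast at h
  exact h.symm

/-- With p = j + 4 this is C(p+1, 4) B₄ / (p+1). The degree j + 1 is positive, so the constant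
correction in `powerSumPoly` plays no role. -/
theorem coeff_powerSumPoly (j : ℕ) :
    (powerSumPoly (j + 4)).coeff (j + 1) =
      -((j + 4 : ℝ) * (j + 3) * (j + 2) / 720) := by
  have hb : _root_.bernoulli 4 = -1 / 30 := by
    rw [bernoulli_eq_bernoulli'_of_ne_one (by norm_num), bernoulli'_four]
  have hc : (((j + 5).choose (j + 1) : ℕ) : ℝ) =
      (j + 5) * (j + 4) * (j + 3) * (j + 2) / 24 := by
    have h := Nat.descFactorial_eq_factorial_mul_choose (j + 5) 4
    simp only [Nat.succ_descFactorial_succ, Nat.descFactorial_zero, Nat.factorial] at h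
    have h' := congrArg (fun m : ℕ => (m : ℝ)) h
    push_cast at h'
    rw [Nat.choose_symm_of_eq_add (show j + 5 = (j + 1) + 4 by ring), eq_div_iff (by norm_num)]
    linarith
  rw [powerSumPoly, coeff_C_mul, coeff_sub, coeff_C_of_ne_zero (by omega), coeff_map, coeff_bernoulli,
    if_pos (by omega), show j + 4 + 1 - (j + 1) = 4 by omega, hb]
  have : ((j + 4 : ℕ) + 1 : ℝ) ≠ 0 := by positivity
  simp only [map_mul, map_natCast, map_div₀, map_neg, map_one, map_ofNat, hc, sub_zero]
  push_cast at this ⊢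
  field_simp
  ring

/-- The Ehrhart polynomial of the lecture hall simplex of the sequence `(a, …, a, a + 1)` of
length `d + 1`. -/
noncomputable def almostConstantEhrhart (d a : ℕ) : ℝ[X] :=
  (preHilbertPoly ℝ (d + 1) 0).comp (C (a : ℝ) * X) +
    ∑ i ∈ Finset.range (d + 1), C ((preHilbertPoly ℝ d 0).coeff i * (a : ℝ) ^ i) * powerSumPoly i

theorem eval_preHilbertPoly_natCast (d m : ℕ) :
    (preHilbertPoly ℝ d 0).eval (m : ℝ) = ((m + d).choose d : ℕ) := by
  simpa using preHilbertPoly_eq_choose_sub_add (F := ℝ) d (Nat.zero_le m)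

/-- Expand C(qa+d, d) in powers of q and exchange the two sums. -/
theorem eval_almostConstantEhrhart (d a t : ℕ) :
    (almostConstantEhrhart d a).eval (t : ℝ) =
      (((t * a + (d + 1)).choose (d + 1) + ∑ q ∈ Finset.range t, (q * a + d).choose d : ℕ) : ℝ) := by
  have h : ∀ q : ℕ, (((q * a + d).choose d : ℕ) : ℝ) =
      ∑ i ∈ Finset.range (d + 1), (preHilbertPoly ℝ d 0).coeff i * (a : ℝ) ^ i * (q : ℝ) ^ i := by
    intro q
    rw [← eval_preHilbertPoly_natCast, eval_eq_sum_range, natDegree_preHilbertPoly]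
    refine Finset.sum_congr rfl fun i _ => ?_
    push_cast
    ring
  rw [almostConstantEhrhart, eval_add, eval_comp, eval_finsetSum, Nat.cast_add, Nat.cast_sum,
    Finset.sum_congr rfl fun q _ => h q, Finset.sum_comm, ← eval_preHilbertPoly_natCast]
  simp only [eval_mul, eval_C, eval_X, eval_powerSumPoly, Finset.mul_sum]
  push_cast
  rw [mul_comm (t : ℝ)]

theorem isEhrhartPolynomial_almostConstantEhrhart (d : ℕ) {a : ℕ} (ha : 0 < a) :
    IsEhrhartPolynomial (lectureHallSimplex (almostConstantSeq (d + 1) a))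
      (almostConstantEhrhart d a) := by
  intro t ht
  rw [latticePointCount_almostConstantSeq d ha ht, sum_choose_floor, eval_almostConstantEhrhart]

theorem coeff_almostConstantEhrhart (d a k : ℕ) :
    (almostConstantEhrhart d a).coeff k =
      (preHilbertPoly ℝ (d + 1) 0).coeff k * (a : ℝ) ^ k +
        ∑ i ∈ Finset.range (d + 1),
          (preHilbertPoly ℝ d 0).coeff i * (powerSumPoly i).coeff k * (a : ℝ) ^ i := by
  rw [almostConstantEhrhart, coeff_add, comp_C_mul_X_coeff, finsetSum_coeff]
  simp only [coeff_C_mul]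
  congr 1
  exact Finset.sum_congr rfl fun i _ => by ring

/-- Only the index i = j + 4 yields a^(j+4); all other terms carry smaller powers of a. -/
theorem isEquivalent_coeff_almostConstantEhrhart (j : ℕ) :
    (fun a : ℕ => (almostConstantEhrhart (j + 4) a).coeff (j + 1)) ~[atTop]
      (fun a : ℕ => -((a : ℝ) ^ (j + 4) / (720 * ((j + 1)! : ℝ)))) := by
  have hpow : ∀ k < j + 4, (fun a : ℕ => (a : ℝ) ^ k) =o[atTop] fun a : ℕ => (a : ℝ) ^ (j + 4) :=
    fun k hk => (isLittleO_pow_pow_atTop_of_lt hk).comp_tendsto tendsto_natCast_atTop_atTop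
  have hlead : (preHilbertPoly ℝ (j + 4) 0).coeff (j + 4) = ((j + 4)! : ℝ)⁻¹ := by
    have := leadingCoeff_preHilbertPoly ℝ (j + 4) 0
    rwa [leadingCoeff, natDegree_preHilbertPoly] at this
  have hterm : ∀ a : ℕ, (preHilbertPoly ℝ (j + 4) 0).coeff (j + 4) *
      (powerSumPoly (j + 4)).coeff (j + 1) * (a : ℝ) ^ (j + 4) =
        -((a : ℝ) ^ (j + 4) / (720 * ((j + 1)! : ℝ))) := by
    intro a
    rw [hlead, coeff_powerSumPoly]
    have : ((j + 1)! : ℝ) ≠ 0 := by positivity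
    have hf : ((j + 4)! : ℝ) = (j + 4) * ((j + 3) * ((j + 2) * (j + 1)!)) := by
      simp only [Nat.factorial_succ (j + 3), Nat.factorial_succ (j + 2), Nat.factorial_succ (j + 1)]
      push_cast
      ring
    rw [hf]
    field_simp
  have hconst : (-(720 * ((j + 1)! : ℝ))⁻¹) ≠ 0 := by
    have : ((j + 1)! : ℝ) ≠ 0 := by positivity
    simp [this]
  have hfun : (fun a : ℕ => -((a : ℝ) ^ (j + 4) / (720 * ((j + 1)! : ℝ)))) =
      fun a : ℕ => -(720 * ((j + 1)! : ℝ))⁻¹ * (a : ℝ) ^ (j + 4) := by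
    funext a
    ring
  rw [IsEquivalent]
  have hsub : ((fun a : ℕ => (almostConstantEhrhart (j + 4) a).coeff (j + 1)) -
      fun a : ℕ => -((a : ℝ) ^ (j + 4) / (720 * ((j + 1)! : ℝ)))) = fun a : ℕ =>
      (preHilbertPoly ℝ (j + 4 + 1) 0).coeff (j + 1) * (a : ℝ) ^ (j + 1) +
        ∑ i ∈ Finset.range (j + 4),
          (preHilbertPoly ℝ (j + 4) 0).coeff i * (powerSumPoly i).coeff (j + 1) * (a : ℝ) ^ i := by
    funext a
    rw [Pi.sub_apply, coeff_almostConstantEhrhart, Finset.sum_range_succ, hterm]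
    ring
  rw [hsub, hfun, isLittleO_const_mul_right_iff hconst]
  refine ((hpow _ (by omega)).const_mul_left _).add (IsLittleO.fun_sum fun i hi => ?_)
  exact (hpow i (Finset.mem_range.1 hi)).const_mul_left _

end EhrhartPolynomial

theorem theorem3p3 (n : ℕ) (hn : 5 ≤ n) :
    (∀ a : ℕ, 0 < a →
      IsEhrhartPolynomial (lectureHallSimplex (almostConstantSeq n a))
        (ehrhartPolynomial (lectureHallSimplex (almostConstantSeq n a)))) ∧
    (∃ α : ℕ, ∀ a : ℕ, α ≤ a →
      ¬ EhrhartPositive (lectureHallSimplex (almostConstantSeq n a))) ∧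
    (fun a : ℕ =>
        (ehrhartPolynomial (lectureHallSimplex (almostConstantSeq n a))).coeff (n - 4))
      ~[atTop]
      (fun a : ℕ => -((a : ℝ) ^ (n - 1) / (720 * ((n - 4)! : ℝ)))) := by
  obtain ⟨j, rfl⟩ : ∃ j, n = j + 4 + 1 := ⟨n - 5, by omega⟩
  have hE : ∀ a : ℕ, 0 < a →
      ehrhartPolynomial (lectureHallSimplex (almostConstantSeq (j + 4 + 1) a)) =
        almostConstantEhrhart (j + 4) a :=
    fun a ha => (isEhrhartPolynomial_almostConstantEhrhart (j + 4) ha).ehrhartPolynomial_eq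
  have hequiv : (fun a : ℕ =>
      (ehrhartPolynomial (lectureHallSimplex (almostConstantSeq (j + 4 + 1) a))).coeff (j + 1))
      ~[atTop] (fun a : ℕ => -((a : ℝ) ^ (j + 4) / (720 * ((j + 1)! : ℝ)))) := by
    refine (isEquivalent_coeff_almostConstantEhrhart j).congr_left ?_
    filter_upwards [eventually_gt_atTop 0] with a ha
    rw [hE a ha]
  refine ⟨fun a ha => ?_, ?_, ?_⟩
  · rw [hE a ha]
    exact isEhrhartPolynomial_almostConstantEhrhart (j + 4) ha
  -- The coefficient is u times a negative quantity with u → 1, hence eventually negative.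
  · obtain ⟨u, hu, hcu⟩ := hequiv.exists_eq_mul
    have hev : ∀ᶠ a : ℕ in atTop,
        (ehrhartPolynomial (lectureHallSimplex (almostConstantSeq (j + 4 + 1) a))).coeff (j + 1)
          < 0 := by
      filter_upwards [hcu, hu.eventually (lt_mem_nhds one_pos), eventually_gt_atTop 0]
        with a h1 h2 ha
      rw [h1, Pi.mul_apply]
      have : (0 : ℝ) < (a : ℝ) ^ (j + 4) / (720 * ((j + 1)! : ℝ)) := by positivity
      nlinarith
    obtain ⟨α, hα⟩ := eventually_atTop.1 hev
    exact ⟨α, fun a ha hpos => (hα a ha).not_ge (hpos (j + 1))⟩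
  · simpa only [show j + 4 + 1 - 4 = j + 1 by omega, show j + 4 + 1 - 1 = j + 4 by omega]
      using hequiv
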